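/- Let $\sigma$ be a relational vocabulary (a set of relation symbols, each with a positive integer arity) and let $k\ge 1$ be an integer. $\sigma$-structures may be infinite or empty. **Logic.** $L_k$ is the set of formulas of $L_{\infty,\omega}(\sigma)$ (atomic formulas, including equality, closed under negation, conjunctions and disjunctions over arbitrary sets, $\exists$ and $\forall$, with finitely many variables in each formula) of quantifier rank at most $k$. Write $A\equiv^{L_k}B$ if $A$ and $B$ satisfy the same sentences of $L_k$. **Forest-ordered structures.** A forest is a poset in which the set of predecessors $\{y : y\le x\}$ of each element $x$ is a finite chain; its roots are its minimal elements and $\prec$ denotes its covering relation. Let $\sigma^+=\sigma\cup\{I\}$ with $I$ a new binary symbol. The category $\mathcal R_k$ has as objects the $\sigma^+$-structures $X$ equipped with a forest order all of whose chains have at most $k$ elements, such that any two distinct elements that occur together in a tuple of some relation of $X$ are comparable. Its morphisms are the $\sigma^+$-homomorphisms that map roots to roots and preserve $\prec$. A morphism is an embedding if it is injective and reflects all relations of $\sigma^+$. A path is an object of $\mathcal R_k$ whose order is linear (it may be empty) and in which $I$ is the identity relation. A path embedding is an embedding whose domain is a path. A morphism $f:X\to Y$ is a pathwise embedding if $f\circ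 e$ is an embedding for every path embedding $e:P\to X$. It is open if, whenever $P,Q$ are paths and $i:P\to Q$, $a:P\to X$, $b:Q\to Y$ are embeddings with $b\circ i=f\circ a$, there is an embedding $d:Q\to X$ with $d\circ i=a$ and $f\circ d=b$. **The object $F_kA$.** For a $\sigma$-structure $A$, the object $F_kA$ of $\mathcal R_k$ is the set of non-empty sequences over $A$ of length at most $k$, with the prefix order. For $R\in\sigma$, $R(s_1,\dots,s_n)$ holds iff the $s_i$ are pairwise comparable and $R^A$ holds of the tuple of their last elements. $I(s,t)$ holds iff $s,t$ are comparable and have the same last element. (This is $\mathbb E_k$ over $\sigma^+$, applied to the expansion of $A$ in which $I$ is the identity, with the prefix order.) Write $A\leftrightarrow_k^{\mathbb E}B$ if there are an object $R$ of $\mathcal R_k$ and open pathwise embeddings $F_kA\leftarrow R\rightarrow F_kB$. **Theorem.** For all $\sigma$-structures $A$ and $B$: $$A\equiv^{L_k}B\iff A\leftrightarrow_k^{\mathbb E}B.$$ If moreover $\sigma$ is finite, then also: $A$ and $B$ satisfy the same first-order sentences of quantifier rank at most $k$ if and only if $A\leftrightarrow_k^{\mathbb E}B$. -/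

import Mathlib

open CategoryTheory
open scoped FirstOrder

universe u

namespace EFComonad

/-! ### Logic: sentences of quantifier rank at most `k`

Throughout, a relational vocabulary is a `FirstOrder.Language` without function symbols and
without nullary relation symbols, and a structure is a Mathlib structure for that language. -/

/-- Formulas of the infinitary logic `L_{∞,ω}` over a relational vocabulary, with free variables
among `x_0, …, x_{n-1}`.  Conjunctions and disjunctions may be indexed by arbitrary sets; the
quantifiers bind the new variable `x_n` of their body. -/
inductive InfFormula (L : FirstOrder.Language.{u, u}) : ℕ → Type (u + 1)
  | equal {n : ℕ} (i j : Fin n) : InfFormula L n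
  | rel {n l : ℕ} (R : L.Relations l) (v : Fin l → Fin n) : InfFormula L n
  | neg {n : ℕ} (φ : InfFormula L n) : InfFormula L n
  | conj {n : ℕ} {ι : Type u} (φ : ι → InfFormula L n) : InfFormula L n
  | disj {n : ℕ} {ι : Type u} (φ : ι → InfFormula L n) : InfFormula L n
  | ex {n : ℕ} (φ : InfFormula L (n + 1)) : InfFormula L n
  | all {n : ℕ} (φ : InfFormula L (n + 1)) : InfFormula L n

namespace InfFormula

variable {L : FirstOrder.Language.{u, u}}

/-- Satisfaction of an infinitary formula under an assignment. -/
def Realize {A : Type u} [L.Structure A] : {n : ℕ} → InfFormula L n → (Fin n → A) → Prop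
  | _, equal i j, x => x i = x j
  | _, rel R v, x => FirstOrder.Language.Structure.RelMap R (fun m => x (v m))
  | _, neg φ, x => ¬ φ.Realize x
  | _, conj φ, x => ∀ i, (φ i).Realize x
  | _, disj φ, x => ∃ i, (φ i).Realize x
  | _, ex φ, x => ∃ a : A, φ.Realize (Fin.snoc x a)
  | _, all φ, x => ∀ a : A, φ.Realize (Fin.snoc x a)

/-- The quantifier rank; the value `⊤` stands for every infinite rank. -/
noncomputable def rank : {n : ℕ} → InfFormula L n → ℕ∞
  | _, equal _ _ => 0
  | _, rel _ _ => 0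
  | _, neg φ => φ.rank
  | _, conj φ => ⨆ i, (φ i).rank
  | _, disj φ => ⨆ i, (φ i).rank
  | _, ex φ => φ.rank + 1
  | _, all φ => φ.rank + 1

end InfFormula

/-- `A ≡ B` for the sentences of `L_{∞,ω}` of quantifier rank at most `k`. -/
def EquivRank (L : FirstOrder.Language.{u, u}) (k : ℕ) (A B : Type u) [L.Structure A] [L.Structure B] :
    Prop :=
  ∀ φ : InfFormula L 0, φ.rank ≤ k →
    (φ.Realize (Fin.elim0 : Fin 0 → A) ↔ φ.Realize (Fin.elim0 : Fin 0 → B))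

/-- Quantifier rank of an ordinary (finitary) first-order formula. -/
def foRank {L : FirstOrder.Language.{u, u}} {α : Type} : {n : ℕ} → L.BoundedFormula α n → ℕ
  | _, .falsum => 0
  | _, .equal _ _ => 0
  | _, .rel _ _ => 0
  | _, .imp φ ψ => max (foRank φ) (foRank ψ)
  | _, .all φ => foRank φ + 1

/-- `A ≡ B` for the first-order sentences of quantifier rank at most `k`. -/
def FOEquivRank (L : FirstOrder.Language.{u, u}) (k : ℕ) (A B : Type u) [L.Structure A] [L.Structure B] :
    Prop :=
  ∀ φ : L.Sentence, foRank φ ≤ k → (A ⊨ φ ↔ B ⊨ φ)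

/-! ### Forest-ordered structures -/

/-- A forest: the predecessors of every element form a finite chain. -/
def IsForest (X : Type u) [PartialOrder X] : Prop :=
  ∀ x : X, (Set.Iic x).Finite ∧ IsChain (· ≤ ·) (Set.Iic x)

/-- Every chain has at most `k` elements. -/
def HeightLE (X : Type u) [PartialOrder X] (k : ℕ) : Prop :=
  ∀ C : Set X, IsChain (· ≤ ·) C → C.encard ≤ k

/-- The Gaifman graph: distinct elements are adjacent when they occur in a common related tuple. -/
def gaifmanGraph (σ : FirstOrder.Language.{u, u}) (X : Type u) [σ.Structure X] : SimpleGraph X where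
  Adj a b := a ≠ b ∧ ∃ (n : ℕ) (R : σ.Relations n) (v : Fin n → X),
    FirstOrder.Language.Structure.RelMap R v ∧ (∃ i, v i = a) ∧ ∃ j, v j = b
  symm := ⟨fun _ _ ⟨hne, n, R, v, hR, ha, hb⟩ => ⟨hne.symm, n, R, v, hR, hb, ha⟩⟩
  loopless := ⟨fun _ h => h.1 rfl⟩

/-- Tree-ordered `σ`-structures of height at most `k`: a structure with a forest order of height
at most `k` in which elements adjacent in the Gaifman graph are comparable. -/
structure TreeStr (σ : FirstOrder.Language.{u, u}) (k : ℕ) where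
  carrier : Type u
  [str : σ.Structure carrier]
  [order : PartialOrder carrier]
  forest : IsForest carrier
  height_le : HeightLE carrier k
  comparable_of_adj : ∀ a b : carrier, (gaifmanGraph σ carrier).Adj a b → a ≤ b ∨ b ≤ a

attribute [instance] TreeStr.str TreeStr.order

namespace TreeStr

variable {σ : FirstOrder.Language.{u, u}} {k : ℕ}

/-- Morphisms: homomorphisms that map roots to roots and preserve the covering relation. -/
@[ext]
structure Hom (X Y : TreeStr σ k) where
  toHom : X.carrier →[σ] Y.carrier
  map_root : ∀ x : X.carrier, IsMin x → IsMin (toHom x)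
  map_covBy : ∀ x y : X.carrier, x ⋖ y → toHom x ⋖ toHom y

instance : Category (TreeStr σ k) where
  Hom := Hom
  id X := ⟨FirstOrder.Language.Hom.id σ X.carrier, fun _ h => h, fun _ _ h => h⟩
  comp f g := ⟨g.toHom.comp f.toHom, fun x h => g.map_root _ (f.map_root x h),
    fun x y h => g.map_covBy _ _ (f.map_covBy x y h)⟩

/-- An embedding is a morphism whose underlying homomorphism is injective and strong. -/
def IsEmbedding {X Y : TreeStr σ k} (f : X ⟶ Y) : Prop :=
  Function.Injective (Hom.toHom f) ∧
    ∀ (n : ℕ) (R : σ.Relations n) (v : Fin n → X.carrier),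
      FirstOrder.Language.Structure.RelMap R (fun i => Hom.toHom f (v i)) → FirstOrder.Language.Structure.RelMap R v

end TreeStr

/-! ### The vocabulary with the identity symbol, and the Ehrenfeucht–Fraïssé comonad on objects -/

/-- The relation symbols of the vocabulary `{I}`, with `I` binary. -/
inductive IdRel : ℕ → Type
  | I : IdRel 2

/-- The vocabulary `{I}`. -/
def idLang : FirstOrder.Language.{0, 0} := ⟨fun _ => Empty, IdRel⟩

instance : idLang.IsRelational := fun _ => inferInstanceAs (IsEmpty Empty)

/-- `σ⁺ = σ ∪ {I}`. -/
abbrev plus (L : FirstOrder.Language.{u, u}) : FirstOrder.Language.{u, u} := L.sum idLang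

/-- The symbol `I` of `σ⁺`. -/
def symI (L : FirstOrder.Language.{u, u}) : (plus L).Relations 2 := Sum.inr IdRel.I

/-- The interpretation of `I` as the identity relation. -/
@[reducible] def idStructure (A : Type u) : idLang.Structure A where
  funMap f := f.elim
  RelMap
    | IdRel.I => fun v => v 0 = v 1

/-- `J A`: the expansion of `A` to `σ⁺` in which `I` is the identity relation. -/
@[reducible] def expand (L : FirstOrder.Language.{u, u}) (A : Type u) [L.Structure A] :
    (plus L).Structure A :=
  @FirstOrder.Language.sumStructure L idLang A _ (idStructure A)

/-- Non-empty sequences over `A` of length at most `k`. -/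
@[ext]
structure Play (k : ℕ) (A : Type u) where
  toList : List A
  ne_nil : toList ≠ []
  length_le : toList.length ≤ k

namespace Play

variable {k : ℕ} {A : Type u}

/-- The counit: the last element of a sequence. -/
def last (s : Play k A) : A := s.toList.getLast s.ne_nil

/-- The prefix order. -/
instance : PartialOrder (Play k A) where
  le s t := s.toList <+: t.toList
  le_refl s := List.prefix_refl s.toList
  le_trans _ _ _ h₁ h₂ := List.IsPrefix.trans h₁ h₂
  le_antisymm _ _ h₁ h₂ := Play.ext (h₁.eq_of_length (le_antisymm h₁.length_le h₂.length_le))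

theorem le_total_of_le {s t r : Play k A} (hs : s ≤ r) (ht : t ≤ r) : s ≤ t ∨ t ≤ s :=
  List.prefix_or_prefix_of_prefix hs ht

theorem eq_of_le_of_length {s t : Play k A} (h : s ≤ t)
    (hl : s.toList.length = t.toList.length) : s = t :=
  Play.ext (List.IsPrefix.eq_of_length h hl)

theorem isForest : IsForest (Play k A) := by
  intro r
  refine ⟨?_, fun s hs t ht _ => le_total_of_le hs ht⟩
  refine Set.Finite.of_finite_image (f := fun s : Play k A => s.toList.length)
    ((Set.finite_Iic k).subset ?_) ?_
  · rintro _ ⟨s, _, rfl⟩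
    exact s.length_le
  · intro s hs t ht hl
    rcases le_total_of_le hs ht with h | h
    · exact eq_of_le_of_length h hl
    · exact (eq_of_le_of_length h hl.symm).symm

theorem heightLE : HeightLE (Play k A) k := by
  intro C hC
  have hinj : Set.InjOn (fun s : Play k A => s.toList.length) C := by
    intro s hs t ht hl
    rcases hC.total hs ht with h | h
    · exact eq_of_le_of_length h hl
    · exact (eq_of_le_of_length h hl.symm).symm
  rw [← hinj.encard_image]
  have hsub : (fun s : Play k A => s.toList.length) '' C ⊆ (Finset.Icc 1 k : Finset ℕ) := by
    rintro _ ⟨s, _, rfl⟩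
    exact Finset.mem_coe.2
      (Finset.mem_Icc.2 ⟨List.length_pos_iff.2 s.ne_nil, s.length_le⟩)
  refine (Set.encard_le_encard hsub).trans ?_
  rw [Set.encard_coe_eq_coe_finsetCard]
  simp

/-- The structure `𝔼_k A`, over an arbitrary relational vocabulary: a tuple of sequences is
related when its members are pairwise comparable and the tuple of last elements is related. -/
@[reducible] def ekStructure (σ : FirstOrder.Language.{u, u}) [σ.IsRelational] (k : ℕ) (A : Type u)
    [σ.Structure A] : σ.Structure (Play k A) where
  funMap f := isEmptyElim f
  RelMap R v := (∀ i j, v i ≤ v j ∨ v j ≤ v i) ∧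
    FirstOrder.Language.Structure.RelMap R (fun i => (v i).last)

end Play

/-- The tree-ordered structure `(𝔼_k A, ⊑)`. -/
def cofree (σ : FirstOrder.Language.{u, u}) [σ.IsRelational] (k : ℕ) (A : Type u) [σ.Structure A] :
    TreeStr σ k :=
  letI : σ.Structure (Play k A) := Play.ekStructure σ k A
  { carrier := Play k A
    forest := Play.isForest
    height_le := Play.heightLE
    comparable_of_adj := by
      rintro a b ⟨_, n, R, v, hR, ⟨i, rfl⟩, ⟨j, rfl⟩⟩
      exact hR.1 i j }

/-- `F_k A`: the construction `(𝔼_k -, ⊑)` over `σ⁺`, applied to `J A`. -/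
def F (L : FirstOrder.Language.{u, u}) [L.IsRelational] (k : ℕ) (A : Type u) [L.Structure A] :
    TreeStr (plus L) k :=
  @cofree (plus L) _ k A (expand L A)

/-! ### Paths, pathwise embeddings, open morphisms, back-and-forth equivalence -/

section Open

variable {L : FirstOrder.Language.{u, u}} {k : ℕ}

/-- A path: the order is linear (a single, possibly empty, branch) and `I` is the identity.
A forest is identified with the tree obtained from it by adding a least element, so the empty
forest is the path consisting of the root alone. -/
def IsPath (P : TreeStr (plus L) k) : Prop :=
  (∀ x y : P.carrier, x ≤ y ∨ y ≤ x) ∧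
    ∀ x y : P.carrier, FirstOrder.Language.Structure.RelMap (symI L) ![x, y] ↔ x = y

/-- A morphism is a pathwise embedding if it sends path embeddings to path embeddings. -/
def IsPathwiseEmbedding {X Y : TreeStr (plus L) k} (f : X ⟶ Y) : Prop :=
  ∀ (P : TreeStr (plus L) k) (e : P ⟶ X), IsPath P → TreeStr.IsEmbedding e →
    TreeStr.IsEmbedding (e ≫ f)

/-- A morphism is open if it has the path-lifting property. -/
def IsOpenMorphism {X Y : TreeStr (plus L) k} (f : X ⟶ Y) : Prop :=
  ∀ (P Q : TreeStr (plus L) k) (i : P ⟶ Q) (a : P ⟶ X) (b : Q ⟶ Y),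
    IsPath P → IsPath Q →
    TreeStr.IsEmbedding i → TreeStr.IsEmbedding a → TreeStr.IsEmbedding b →
    i ≫ b = a ≫ f →
    ∃ d : Q ⟶ X, TreeStr.IsEmbedding d ∧ i ≫ d = a ∧ d ≫ f = b

end Open

/-- The back-and-forth equivalence `A ↔_k^𝔼 B`: a span of open pathwise embeddings
`F_k A ⟵ R ⟶ F_k B`. -/
def BackAndForth (L : FirstOrder.Language.{u, u}) [L.IsRelational] (k : ℕ) (A B : Type u)
    [L.Structure A] [L.Structure B] : Prop :=
  ∃ (R : TreeStr (plus L) k) (p : R ⟶ F L k A) (q : R ⟶ F L k B),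
    (IsOpenMorphism p ∧ IsPathwiseEmbedding p) ∧ (IsOpenMorphism q ∧ IsPathwiseEmbedding q)

end EFComonad

/-! Both equivalences pass through the k-round Ehrenfeucht–Fraïssé game, encoded by `DuplicatorWins
L k ∅`, whose positions are sets of pairs.

Logic and game: a quantifier corresponds to one round, so a winning position preserves formulas of
bounded rank (`DuplicatorWins.realize_iff`). Conversely, if a move `a` has no good answer, each `b`
is excluded by some formula true of `a`, and the existential closure of their conjunction separates
the two structures (`duplicatorWins_of_realize_iff`). Over a finite vocabulary finitely many
finitary formulas suffice (`exists_finite_deciding_family`).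

Spans and game: a path embedded in `F L k A` is a branch given by a list without repetition, because
`I` must be the identity on it. Given a span of open pathwise embeddings, a path in `R` embeds in
both feet at once, so matching last elements gives a partial isomorphism. Openness of one leg
lengthens the path to contain Spoiler's move, and the other leg reads off Duplicator's answer
(`exists_path_extension`, `duplicatorWins_spanPosition`). Conversely, the lists of pairs all of
whose initial segments are winning form a tree whose two projections are open pathwise embeddings:
Duplicator's answers are exactly one-step lifts (`playProj_isOpenMorphism`,
`DuplicatorWins.backAndForth`). -/

namespace EFComonad

open FirstOrder.Language (Structure BoundedFormula)

/-! ### Forest orders and tree morphisms -/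

namespace TreeStr

variable {σ : FirstOrder.Language.{u, u}} {k : ℕ} {X Y Z : TreeStr σ k}

theorem hom_ext {f g : X ⟶ Y} (h : ∀ x, Hom.toHom f x = Hom.toHom g x) : f = g :=
  Hom.ext (FirstOrder.Language.Hom.ext h)

/-- Morphisms are monotone. -/
theorem hom_mono (f : X ⟶ Y) : Monotone (Hom.toHom f) := by
  classical
  let _ : LocallyFiniteOrder X.carrier := LocallyFiniteOrder.ofFiniteIcc fun a b =>
    (X.forest b).1.subset fun _ h => h.2
  exact monotone_iff_forall_covBy _ |>.2 fun a b h => (f.map_covBy a b h).le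

/-- The image of a principal lower set under a morphism is a principal lower set. -/
theorem exists_eq_of_le_map (f : X ⟶ Y) (x : X.carrier) {y : Y.carrier}
    (h : y ≤ Hom.toHom f x) : ∃ x' ≤ x, Hom.toHom f x' = y := by
  obtain ⟨n, hn⟩ : ∃ n, n = (Set.Iic x).ncard := ⟨_, rfl⟩
  induction n using Nat.strong_induction_on generalizing x with
  | _ n ih =>
    by_cases hx : IsMin x
    · exact ⟨x, le_rfl, ((f.map_root x hx).eq_of_le h).symm⟩
    · rcases eq_or_lt_of_le h with h | h
      · exact ⟨x, le_rfl, h.symm⟩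
      obtain ⟨z, hz⟩ := not_isMin_iff.1 hx
      have hfin : (Set.Iio x).Finite := (X.forest x).1.subset Set.Iio_subset_Iic_self
      obtain ⟨w, hw⟩ := hfin.exists_maximal ⟨z, hz⟩
      have hcov : w ⋖ x := ⟨hw.1, fun c h1 h2 => (hw.2 h2 h1.le).not_gt h1⟩
      have hf := f.map_covBy _ _ hcov
      -- `f w` is covered by `f x` and the elements below `f x` form a chain, so whatever lies
      -- strictly below `f x` lies below `f w`.
      have hy : y ≤ Hom.toHom f w := by
        rcases (Y.forest (Hom.toHom f x)).2.total h.le hf.le with h' | h'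
        · exact h'
        · rcases eq_or_lt_of_le h' with h' | h'
          · exact h'.ge
          · exact (hf.2 h' h).elim
      have hlt : (Set.Iic w).ncard < n := by
        rw [hn]
        exact Set.ncard_lt_ncard (Set.Iic_ssubset_Iic.2 hcov.lt) (X.forest x).1
      obtain ⟨x', hx', rfl⟩ := ih _ hlt w hy rfl
      exact ⟨x', hx'.trans hcov.le, rfl⟩

theorem IsEmbedding.of_comp {f : X ⟶ Y} {g : Y ⟶ Z} (h : IsEmbedding (f ≫ g)) :
    IsEmbedding f :=
  ⟨fun _ _ hxy => h.1 (congrArg (Hom.toHom g) hxy),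
    fun n R v hv => h.2 n R v ((Hom.toHom g).map_rel R _ hv)⟩

variable [σ.IsRelational]

/-- The restriction of a tree-ordered structure to a lower set. -/
def restrict (X : TreeStr σ k) (S : Set X.carrier) (_ : IsLowerSet S) : TreeStr σ k :=
  letI : σ.Structure S :=
    { funMap := fun f => isEmptyElim f
      RelMap := fun R v => Structure.RelMap R fun i => (v i : X.carrier) }
  { carrier := S
    forest := fun x => by
      refine ⟨Set.Finite.preimage Subtype.val_injective.injOn (X.forest x).1, ?_⟩
      intro a ha b hb _
      exact (X.forest x).2.total ha hb
    height_le := fun C hC => by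
      rw [← Subtype.val_injective.encard_image]
      exact X.height_le _ (by
        rintro _ ⟨a, ha, rfl⟩ _ ⟨b, hb, rfl⟩ _
        exact hC.total ha hb)
    comparable_of_adj := by
      rintro a b ⟨hne, n, R, v, hR, ⟨i, rfl⟩, ⟨j, rfl⟩⟩
      exact X.comparable_of_adj _ _
        ⟨fun h => hne (Subtype.ext h), n, R, _, hR, ⟨i, rfl⟩, ⟨j, rfl⟩⟩ }

/-- The inclusion of a lower set. -/
def incl (X : TreeStr σ k) (S : Set X.carrier) (hS : IsLowerSet S) : X.restrict S hS ⟶ X where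
  toHom :=
    { toFun := fun x : S => x.1
      map_fun' := fun f => isEmptyElim f
      map_rel' := fun _ _ h => h }
  map_root := fun x hx y hy => hx (b := (⟨y, hS hy x.2⟩ : S)) hy
  map_covBy := fun _ y h => ⟨h.1, fun z h1 h2 => h.2 (c := (⟨z, hS h2.le y.2⟩ : S)) h1 h2⟩

theorem incl_isEmbedding (X : TreeStr σ k) (S : Set X.carrier) (hS : IsLowerSet S) :
    IsEmbedding (X.incl S hS) :=
  ⟨fun _ _ h => Subtype.ext h, fun _ _ _ h => h⟩

/-- The corestriction of a morphism to a lower set containing its image. -/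
def lift (f : X ⟶ Y) (S : Set Y.carrier) (hS : IsLowerSet S) (h : ∀ x, Hom.toHom f x ∈ S) :
    X ⟶ Y.restrict S hS where
  toHom :=
    { toFun := fun x => (⟨Hom.toHom f x, h x⟩ : S)
      map_fun' := fun f => isEmptyElim f
      map_rel' := fun R v hv => (Hom.toHom f).map_rel R v hv }
  map_root := fun _ hx _ hy => f.map_root _ hx hy
  map_covBy := fun x y hxy => ⟨(f.map_covBy x y hxy).1, fun _ h1 h2 =>
    (f.map_covBy x y hxy).2 h1 h2⟩

end TreeStr

/-! ### Plays -/

namespace Play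

variable {k : ℕ} {C D : Type u}

theorem last_mem {s : Play k C} {l : List C} (h : s.toList <+: l) : s.last ∈ l :=
  h.subset (List.getLast_mem s.ne_nil)

theorem length_pos (s : Play k C) : 0 < s.toList.length := List.length_pos_iff.2 s.ne_nil

/-- A non-empty initial segment of a list, as a play. -/
def take (l : List C) (hl : l.length ≤ k) (n : ℕ) (hn : 0 < n) (hnl : n ≤ l.length) :
    Play k C where
  toList := l.take n
  ne_nil := List.ne_nil_of_length_pos (by simp; omega)
  length_le := by simp; omega

/-- The image of a play under a map. -/
def map (π : D → C) (s : Play k D) : Play k C where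
  toList := s.toList.map π
  ne_nil := by simpa using s.ne_nil
  length_le := by simpa using s.length_le

theorem last_map (π : D → C) (s : Play k D) : (s.map π).last = π s.last :=
  List.getLast_map _

theorem isMin_iff {s : Play k C} : IsMin s ↔ s.toList.length = 1 := by
  have hs := s.length_pos
  constructor
  · intro h
    have h1 : take s.toList s.length_le 1 one_pos hs ≤ s := List.take_prefix _ _
    have h2 := List.IsPrefix.length_le (h h1)
    simp [take] at h2
    omega
  · intro h t ht
    have h1 := t.length_pos
    have h2 := List.IsPrefix.length_le ht
    exact (eq_of_le_of_length ht (by omega)).ge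

theorem covBy_iff {s t : Play k C} :
    s ⋖ t ↔ s ≤ t ∧ t.toList.length = s.toList.length + 1 := by
  constructor
  · intro h
    refine ⟨h.le, ?_⟩
    have h1 := List.IsPrefix.length_le h.le
    have h2 : s.toList.length ≠ t.toList.length := fun h' => h.ne (eq_of_le_of_length h.le h')
    by_contra h3
    have h4 : s.toList.length + 1 ≤ t.toList.length := by omega
    let r : Play k C := take t.toList t.length_le (s.toList.length + 1) (by omega) h4
    have hrl : r.toList.length = s.toList.length + 1 := by simp [r, take]; omega
    have hrt : r ≤ t := List.take_prefix _ _
    have hsr : s ≤ r := List.prefix_of_prefix_length_le h.le hrt (by omega)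
    refine h.2 (c := r) (lt_of_le_of_ne hsr ?_) (lt_of_le_of_ne hrt ?_)
    · rintro h; rw [← h] at hrl; omega
    · rintro h; rw [h] at hrl; omega
  · rintro ⟨h, hl⟩
    refine ⟨lt_of_le_of_ne h fun h' => ?_, fun r h1 h2 => ?_⟩
    · rw [h'] at hl; omega
    · have h3 := List.IsPrefix.length_le h1.le
      have h4 := List.IsPrefix.length_le h2.le
      rcases (show r.toList.length = s.toList.length ∨ r.toList.length = t.toList.length by
        omega) with h5 | h5
      · exact h1.ne (eq_of_le_of_length h1.le h5.symm)
      · exact h2.ne (eq_of_le_of_length h2.le h5)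

/-- A finite pairwise comparable family of plays is empty or has a largest member. -/
theorem eq_zero_or_exists_max {n : ℕ} (v : Fin n → Play k C)
    (h : ∀ i j, v i ≤ v j ∨ v j ≤ v i) : n = 0 ∨ ∃ i, ∀ j, v j ≤ v i := by
  rcases Nat.eq_zero_or_pos n with hn | hn
  · exact Or.inl hn
  · have : Nonempty (Fin n) := ⟨⟨0, hn⟩⟩
    obtain ⟨i, hi⟩ := Finite.exists_max fun i => (v i).toList.length
    refine Or.inr ⟨i, fun j => ?_⟩
    rcases h j i with h | h
    · exact h
    · exact (eq_of_le_of_length h (le_antisymm (List.IsPrefix.length_le h) (hi j))).ge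

end Play

theorem finite_of_linear {σ : FirstOrder.Language.{u, u}} {k : ℕ} {P : TreeStr σ k}
    (hP : ∀ x y : P.carrier, x ≤ y ∨ y ≤ x) :
    Finite P.carrier := by
  rw [← Set.finite_univ_iff]
  exact Set.finite_of_encard_le_coe (P.height_le Set.univ fun x _ y _ _ => hP x y)

/-- A pairwise comparable tuple has a largest member, and its list contains all the last elements,
so one list satisfying `W` controls the whole tuple. `h0` settles the tuple of length zero. -/
theorem relMap_last_iff {σ : FirstOrder.Language.{u, u}} {k : ℕ} {C D : Type u} [σ.Structure C]
    [σ.Structure D] {W : List D → Prop} {π : D → C} (h0 : W [])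
    (hrel : ∀ l, W l → ∀ (n : ℕ) (R : σ.Relations n) (v : Fin n → D), (∀ i, v i ∈ l) →
      (Structure.RelMap R v ↔ Structure.RelMap R (fun i => π (v i))))
    {n : ℕ} (R : σ.Relations n) (v : Fin n → Play k D)
    (hv : ∀ i, W (v i).toList) (hc : ∀ i j, v i ≤ v j ∨ v j ≤ v i) :
    Structure.RelMap R (fun i => (v i).last) ↔
      Structure.RelMap R (fun i => ((v i).map π).last) := by
  simp only [Play.last_map]
  rcases Play.eq_zero_or_exists_max v hc with rfl | ⟨i, hi⟩
  · exact hrel [] h0 0 R _ fun i => i.elim0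
  · exact hrel _ (hv i) n R _ fun j => Play.last_mem (hi j)

/-! ### Branches of the cofree object and trees of plays -/

section Cofree

variable {σ : FirstOrder.Language.{u, u}} [σ.IsRelational] {k : ℕ} {C D : Type u}
  [σ.Structure C] [σ.Structure D]

/-- The image of a linear order in `cofree σ k C` is the set of initial segments of a list. -/
theorem exists_list_of_linear {P : TreeStr σ k} (hP : ∀ x y : P.carrier, x ≤ y ∨ y ≤ x)
    (f : P ⟶ cofree σ k C) :
    ∃ l : List C, l.length ≤ k ∧ l.length ≤ Nat.card P.carrier ∧
      ∀ s : Play k C, s.toList <+: l ↔ ∃ x, TreeStr.Hom.toHom f x = s := by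
  have := finite_of_linear hP
  rcases isEmpty_or_nonempty P.carrier with hE | hN
  · exact ⟨[], by simp, by simp, fun s => by simp [s.ne_nil]⟩
  · obtain ⟨m, -, hm⟩ := Set.finite_univ.exists_maximal (Set.univ_nonempty (α := P.carrier))
    let s : Play k C := TreeStr.Hom.toHom f m
    have key : ∀ t : Play k C, t.toList <+: s.toList ↔ ∃ x, TreeStr.Hom.toHom f x = t := by
      intro t
      constructor
      · intro h
        obtain ⟨x, _, hx⟩ := TreeStr.exists_eq_of_le_map f m (y := t) h
        exact ⟨x, hx⟩
      · rintro ⟨x, rfl⟩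
        refine TreeStr.hom_mono f (?_ : x ≤ m)
        rcases hP x m with h | h
        · exact h
        · exact hm (Set.mem_univ x) h
    refine ⟨s.toList, s.length_le, ?_, key⟩
    -- Each initial segment of `s` has a preimage, and distinct lengths give distinct preimages. The
    -- shift `j + 1` avoids the empty list, which is not a play.
    have h : ∀ j : Fin s.toList.length, ∃ x, TreeStr.Hom.toHom f x =
        Play.take s.toList s.length_le (j + 1) (by omega) (by omega) :=
      fun j => (key _).1 (List.take_prefix _ _)
    choose g hg using h
    have hinj : Function.Injective g := by
      intro i j hij
      have h1 := (hg i).symm.trans ((congrArg _ hij).trans (hg j))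
      have h2 := congrArg (fun t : Play k C => t.toList.length) h1
      simp [Play.take] at h2
      omega
    simpa using Nat.card_le_card_of_injective g hinj

/-- The plays whose underlying list satisfies `W`. -/
def playTree (σ : FirstOrder.Language.{u, u}) [σ.IsRelational] (k : ℕ) [σ.Structure D]
    (W : List D → Prop)
    (hW : ∀ l l' : List D, l <+: l' → W l' → W l) : TreeStr σ k :=
  (cofree σ k D).restrict {s : Play k D | W s.toList} fun _ _ h hs => hW _ _ h hs

variable {W : List D → Prop} {π : D → C}

/-- The morphism induced by a map which preserves relations along the plays. -/
def playProj (h0 : W []) (hW : ∀ l l' : List D, l <+: l' → W l' → W l) (π : D → C)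
    (hrel : ∀ l, W l → ∀ (n : ℕ) (R : σ.Relations n) (v : Fin n → D), (∀ i, v i ∈ l) →
      (Structure.RelMap R v ↔ Structure.RelMap R (fun i => π (v i)))) :
    playTree σ k W hW ⟶ cofree σ k C where
  toHom :=
    { toFun := fun s : {s : Play k D // W s.toList} => Play.map π s.1
      map_fun' := fun f => isEmptyElim f
      map_rel' := fun R v h =>
        ⟨fun i j => (h.1 i j).imp (fun h => List.IsPrefix.map π h) fun h => List.IsPrefix.map π h,
          (relMap_last_iff h0 hrel R (fun i => (v i).1) (fun i => (v i).2) h.1).1 h.2⟩ }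
  map_root := fun s hs => by
    have h := Play.isMin_iff.1 (((cofree σ k D).incl _ _).map_root s hs)
    exact Play.isMin_iff.2 ((List.length_map _).trans h)
  map_covBy := fun s t hst => by
    have h := Play.covBy_iff.1 (((cofree σ k D).incl _ _).map_covBy s t hst)
    exact Play.covBy_iff.2 ⟨h.1.map π, by
      have h2 := h.2
      refine (List.length_map _).trans (h2.trans ?_)
      exact congrArg (· + 1) (List.length_map _).symm⟩

/-- Along a list, a map with one-step lifting lifts arbitrary extensions. -/
theorem exists_lift_list
    (hext : ∀ l, W l → l.length < k → ∀ c : C, ∃ d : D, π d = c ∧ W (l ++ [d]))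
    (m : List C) (l : List D) (hl : W l) (hk : l.length + m.length ≤ k) :
    ∃ l', l <+: l' ∧ W l' ∧ l'.map π = l.map π ++ m := by
  induction m generalizing l with
  | nil => exact ⟨l, List.prefix_rfl, hl, by simp⟩
  | cons c m ih =>
    simp only [List.length_cons] at hk
    obtain ⟨d, rfl, hd⟩ := hext l hl (by omega) c
    obtain ⟨l', h1, h2, h3⟩ := ih _ hd (by simp; omega)
    exact ⟨l', (List.prefix_append _ _).trans h1, h2, by simp [h3]⟩

theorem map_take_eq {s : Play k C} {l' : List D} (h : s.toList <+: l'.map π) :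
    (l'.take s.toList.length).map π = s.toList := by
  rw [List.map_take]
  exact (List.prefix_iff_eq_take.1 h).symm

end Cofree

/-! ### Projections of trees of plays are open pathwise embeddings -/

section Projection

variable {L : FirstOrder.Language.{u, u}} [L.IsRelational] {k : ℕ} {C D : Type u}
  [(plus L).Structure C] [(plus L).Structure D]
  {W : List D → Prop} (h0 : W []) (hW : ∀ l l' : List D, l <+: l' → W l' → W l) (π : D → C)
  (hrel : ∀ l, W l → ∀ (n : ℕ) (R : (plus L).Relations n) (v : Fin n → D), (∀ i, v i ∈ l) →
      (Structure.RelMap R v ↔ Structure.RelMap R (fun i => π (v i))))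

/-- Mapping a list keeps its length, and comparable plays of equal length coincide, so the
projection is injective on chains. Along a chain relations are reflected by `relMap_last_iff`. -/
theorem playProj_isPathwiseEmbedding :
    IsPathwiseEmbedding (playProj (k := k) h0 hW π hrel) := by
  intro P e hP he
  have hmono := TreeStr.hom_mono e
  refine ⟨fun x y hxy => he.1 (Subtype.ext ?_), fun n R v hv => he.2 n R v ?_⟩
  · let s : {s : Play k D // W s.toList} := TreeStr.Hom.toHom e x
    let t : {s : Play k D // W s.toList} := TreeStr.Hom.toHom e y
    have hxy' : s.1.map π = t.1.map π := hxy
    have hl : s.1.toList.length = t.1.toList.length := by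
      have := congrArg (fun r : Play k C => r.toList.length) hxy'
      simpa [Play.map] using this
    rcases hP.1 x y with h | h
    · exact Play.eq_of_le_of_length (hmono h) hl
    · exact (Play.eq_of_le_of_length (hmono h) hl.symm).symm
  · let w : Fin n → {s : Play k D // W s.toList} := fun i => TreeStr.Hom.toHom e (v i)
    have hc : ∀ i j, (w i).1 ≤ (w j).1 ∨ (w j).1 ≤ (w i).1 := fun i j =>
      (hP.1 (v i) (v j)).imp (fun h => hmono h) (fun h => hmono h)
    exact ⟨hc, (relMap_last_iff h0 hrel R (fun i => (w i).1) (fun i => (w i).2) hc).2 hv.2⟩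

/-- The images of `P` and `Q` are the initial segments of lists `lP` and `lQ`, and `lP` projects
onto a prefix of `lQ`. Lifting the remaining entries one at a time gives a list `l'` over `lQ`; each
element of `Q` goes to the initial segment of `l'` of the length prescribed by `b`. -/
theorem playProj_isOpenMorphism
    (hext : ∀ l, W l → l.length < k → ∀ c : C, ∃ d : D, π d = c ∧ W (l ++ [d])) :
    IsOpenMorphism (playProj (k := k) h0 hW π hrel) := by
  intro P Q i a b hP hQ _ _ hb hcomm
  let a' : P.carrier → {s : Play k D // W s.toList} := fun x => TreeStr.Hom.toHom a x
  let b' : Q.carrier → Play k C := fun x => TreeStr.Hom.toHom b x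
  have hab : ∀ x, (a' x).1.map π = b' (TreeStr.Hom.toHom i x) := fun x =>
    (congrArg (fun f => TreeStr.Hom.toHom f x) hcomm).symm
  obtain ⟨lQ, hkQ, -, hlQ⟩ := exists_list_of_linear hQ.1 b
  obtain ⟨lP, hkP, -, hlP⟩ :=
    exists_list_of_linear hP.1 (a ≫ (cofree (plus L) k D).incl _ _)
  have hlP' : lP = [] ∨ ∃ x, (a' x).1.toList = lP := by
    by_cases hne : lP = []
    · exact Or.inl hne
    · obtain ⟨x, hx⟩ := (hlP ⟨lP, hne, hkP⟩).1 List.prefix_rfl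
      exact Or.inr ⟨x, congrArg Play.toList hx⟩
  have hWP : W lP := by
    rcases hlP' with rfl | ⟨x, rfl⟩
    · exact h0
    · exact (a' x).2
  have hpre : lP.map π <+: lQ := by
    rcases hlP' with rfl | ⟨x, rfl⟩
    · simp
    · exact (hlQ ((a' x).1.map π)).2 ⟨_, (hab x).symm⟩
  obtain ⟨m, rfl⟩ := hpre
  obtain ⟨l', hPl', hWl', hmap⟩ :=
    exists_lift_list hext m lP hWP (by simpa using hkQ)
  rw [← hmap] at hlQ hkQ
  have hbl : ∀ x, (b' x).toList <+: l'.map π := fun x => (hlQ _).2 ⟨x, rfl⟩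
  have hlen : ∀ x, (b' x).toList.length ≤ l'.length := fun x => by
    simpa using (hbl x).length_le
  let d' : Q.carrier → {s : Play k D // W s.toList} := fun x =>
    ⟨Play.take l' (by simpa using hkQ) (b' x).toList.length (b' x).length_pos (hlen x),
      hW _ _ (List.take_prefix _ _) hWl'⟩
  have hd'len : ∀ x, (d' x).1.toList.length = (b' x).toList.length := fun x => by
    simpa [d', Play.take] using hlen x
  have hd'pre : ∀ x, (d' x).1.toList <+: l' := fun x => List.take_prefix _ _
  have hd'c : ∀ x y, (d' x).1 ≤ (d' y).1 ∨ (d' y).1 ≤ (d' x).1 := fun x y =>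
    List.prefix_or_prefix_of_prefix (hd'pre x) (hd'pre y)
  have hd'b : ∀ x, (d' x).1.map π = b' x := fun x => Play.ext (map_take_eq (hbl x))
  let d : Q ⟶ playTree (plus L) k W hW :=
    { toHom :=
        { toFun := d'
          map_fun' := fun f => isEmptyElim f
          map_rel' := fun {n} R v hv => by
            refine ⟨fun i j => hd'c (v i) (v j), ?_⟩
            refine (relMap_last_iff h0 hrel R (fun i => (d' (v i)).1) (fun i => (d' (v i)).2)
              fun i j => hd'c _ _).2 ?_
            simp only [hd'b]
            exact ((TreeStr.Hom.toHom b).map_rel R v hv).2 }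
      map_root := fun x hx => by
        have h1 := Play.isMin_iff.1 (b.map_root x hx)
        intro t ht
        have h2 : IsMin (d' x).1 := Play.isMin_iff.2 ((hd'len x).trans h1)
        exact h2 (b := Subtype.val (p := fun s : Play k D => W s.toList) t) ht
      map_covBy := fun x y hxy => by
        have h1 := Play.covBy_iff.1 (b.map_covBy x y hxy)
        have h2 : (d' x).1 ⋖ (d' y).1 := by
          refine Play.covBy_iff.2 ⟨?_, ?_⟩
          · refine List.prefix_of_prefix_length_le (hd'pre x) (hd'pre y) ?_
            rw [hd'len, hd'len]
            exact h1.1.length_le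
          · rw [hd'len, hd'len]
            exact h1.2
        exact ⟨h2.1, fun r hr1 hr2 => h2.2
          (c := Subtype.val (p := fun s : Play k D => W s.toList) r) hr1 hr2⟩ }
  have hdp : d ≫ playProj h0 hW π hrel = b := TreeStr.hom_ext hd'b
  refine ⟨d, TreeStr.IsEmbedding.of_comp (hdp ▸ hb), TreeStr.hom_ext fun x => ?_, hdp⟩
  refine Subtype.ext (Play.ext ?_)
  have h1 : (a' x).1.toList <+: l' := ((hlP _).2 ⟨x, rfl⟩).trans hPl'
  have h2 : (b' (TreeStr.Hom.toHom i x)).toList.length = (a' x).1.toList.length := by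
    rw [← hab]
    exact List.length_map _
  change l'.take (b' (TreeStr.Hom.toHom i x)).toList.length = (a' x).1.toList
  rw [h2]
  exact (List.prefix_iff_eq_take.1 h1).symm

end Projection

/-! ### The Ehrenfeucht–Fraïssé game -/

section Game

variable (L : FirstOrder.Language.{u, u}) {A B : Type u} [L.Structure A] [L.Structure B]

/-- A set of pairs that is the graph of a partial isomorphism. -/
structure IsPartialIso (ρ : Set (A × B)) : Prop where
  eq_iff : ∀ x ∈ ρ, ∀ y ∈ ρ, x.1 = y.1 ↔ x.2 = y.2
  rel_iff : ∀ (n : ℕ) (R : L.Relations n) (v : Fin n → A × B), (∀ i, v i ∈ ρ) →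
    (Structure.RelMap R (fun i => (v i).1) ↔ Structure.RelMap R (fun i => (v i).2))

/-- Duplicator wins the game with the given number of rounds from the given position. -/
def DuplicatorWins : ℕ → Set (A × B) → Prop
  | 0, ρ => IsPartialIso L ρ
  | n + 1, ρ => IsPartialIso L ρ ∧ (∀ a, ∃ b, DuplicatorWins n (insert (a, b) ρ)) ∧
      ∀ b, ∃ a, DuplicatorWins n (insert (a, b) ρ)

variable {L}

theorem DuplicatorWins.isPartialIso {n : ℕ} {ρ : Set (A × B)} (h : DuplicatorWins L n ρ) :
    IsPartialIso L ρ := by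
  cases n with
  | zero => exact h
  | succ n => exact h.1

theorem range_snoc_prodMk {n : ℕ} (x : Fin n → A) (y : Fin n → B) (a : A) (b : B) :
    Set.range (fun i => ((Fin.snoc x a : Fin (n + 1) → A) i, (Fin.snoc y b : Fin (n + 1) → B) i)) =
      insert (a, b) (Set.range fun i => (x i, y i)) := by
  ext p
  constructor
  · rintro ⟨i, rfl⟩
    induction i using Fin.lastCases with
    | last => simp
    | cast i => exact Or.inr ⟨i, by simp⟩
  · rintro (rfl | ⟨i, rfl⟩)
    · exact ⟨Fin.last n, by simp⟩
    · exact ⟨i.castSucc, by simp⟩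

theorem isPartialIso_range_iff {n : ℕ} {x : Fin n → A} {y : Fin n → B} :
    IsPartialIso L (Set.range fun i => (x i, y i)) ↔
      (∀ i j, x i = x j ↔ y i = y j) ∧ ∀ (l : ℕ) (R : L.Relations l) (v : Fin l → Fin n),
        Structure.RelMap R (fun i => x (v i)) ↔ Structure.RelMap R (fun i => y (v i)) := by
  constructor
  · intro h
    exact ⟨fun i j => h.eq_iff _ ⟨i, rfl⟩ _ ⟨j, rfl⟩,
      fun l R v => h.rel_iff l R (fun i => (x (v i), y (v i))) fun i => ⟨v i, rfl⟩⟩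
  · rintro ⟨h1, h2⟩
    refine ⟨?_, fun l R v hv => ?_⟩
    · rintro _ ⟨i, rfl⟩ _ ⟨j, rfl⟩
      exact h1 i j
    · choose w hw using hv
      obtain rfl : (fun i => (x (w i), y (w i))) = v := funext hw
      exact h2 l R w

/-! ### Winning positions preserve formulas -/

/-- A witness for a quantifier is a move, and Duplicator's answer is the witness on the other side,
at the cost of one round. Connectives of any size cost none. -/
theorem DuplicatorWins.realize_iff {n : ℕ} (φ : InfFormula L n) (m : ℕ) (hφ : φ.rank ≤ m)
    {x : Fin n → A} {y : Fin n → B} (h : DuplicatorWins L m (Set.range fun i => (x i, y i))) :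
    φ.Realize x ↔ φ.Realize y := by
  induction φ generalizing m with
  | equal i j => exact (isPartialIso_range_iff.1 h.isPartialIso).1 i j
  | rel R v => exact (isPartialIso_range_iff.1 h.isPartialIso).2 _ R v
  | neg φ ih => exact not_congr (ih m hφ h)
  | conj φ ih => exact forall_congr' fun i => ih i m ((le_iSup _ i).trans hφ) h
  | disj φ ih => exact exists_congr fun i => ih i m ((le_iSup _ i).trans hφ) h
  | ex φ ih =>
    obtain _ | m := m
    · simp [InfFormula.rank] at hφ
    have hφ' : φ.rank ≤ m :=
      (WithTop.add_le_add_iff_right WithTop.one_ne_top).1 (by exact_mod_cast hφ)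
    constructor
    · rintro ⟨a, ha⟩
      obtain ⟨b, hb⟩ := h.2.1 a
      exact ⟨b, (ih m hφ' (by rwa [range_snoc_prodMk])).1 ha⟩
    · rintro ⟨b, hb⟩
      obtain ⟨a, ha⟩ := h.2.2 b
      exact ⟨a, (ih m hφ' (by rwa [range_snoc_prodMk])).2 hb⟩
  | all φ ih =>
    obtain _ | m := m
    · simp [InfFormula.rank] at hφ
    have hφ' : φ.rank ≤ m :=
      (WithTop.add_le_add_iff_right WithTop.one_ne_top).1 (by exact_mod_cast hφ)
    constructor
    · intro hx b
      obtain ⟨a, ha⟩ := h.2.2 b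
      exact (ih m hφ' (by rwa [range_snoc_prodMk])).1 (hx a)
    · intro hx a
      obtain ⟨b, hb⟩ := h.2.1 a
      exact (ih m hφ' (by rwa [range_snoc_prodMk])).2 (hx b)

theorem term_eq_var [L.IsRelational] {n : ℕ} (t : L.Term (Empty ⊕ Fin n)) :
    ∃ i : Fin n, t = .var (Sum.inr i) := by
  cases t with
  | var i =>
    rcases i with i | i
    · exact i.elim
    · exact ⟨i, rfl⟩
  | func f _ => exact isEmptyElim f

theorem DuplicatorWins.realize_boundedFormula_iff [L.IsRelational] {n : ℕ}
    (φ : L.BoundedFormula Empty n) (m : ℕ) (hφ : foRank φ ≤ m) {v : Empty → A} {w : Empty → B}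
    {x : Fin n → A} {y : Fin n → B} (h : DuplicatorWins L m (Set.range fun i => (x i, y i))) :
    φ.Realize v x ↔ φ.Realize w y := by
  induction φ generalizing m with
  | falsum => exact Iff.rfl
  | equal s t =>
    obtain ⟨i, rfl⟩ := term_eq_var s
    obtain ⟨j, rfl⟩ := term_eq_var t
    exact (isPartialIso_range_iff.1 h.isPartialIso).1 i j
  | rel R ts =>
    choose f hf using fun i => term_eq_var (ts i)
    obtain rfl : ts = fun i => .var (Sum.inr (f i)) := funext hf
    exact (isPartialIso_range_iff.1 h.isPartialIso).2 _ R f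
  | imp φ ψ ih1 ih2 =>
    exact imp_congr (ih1 m ((le_max_left _ _).trans hφ) h) (ih2 m ((le_max_right _ _).trans hφ) h)
  | all φ ih =>
    obtain _ | m := m
    · simp [foRank] at hφ
    have hφ' : foRank φ ≤ m := Nat.le_of_succ_le_succ hφ
    constructor
    · intro hx b
      obtain ⟨a, ha⟩ := h.2.2 b
      exact (ih m hφ' (by rwa [range_snoc_prodMk])).1 (hx a)
    · intro hx a
      obtain ⟨b, hb⟩ := h.2.1 a
      exact (ih m hφ' (by rwa [range_snoc_prodMk])).2 (hx b)

/-! ### Equivalent positions are winning -/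

/-- If a move has no winning answer, every candidate answer is excluded by a formula of rank at most
`m`. The conjunction over all candidates, possibly infinite, still has rank at most `m`, and
quantifying it gives a separating formula of rank at most `m + 1`. -/
theorem duplicatorWins_of_realize_iff (m : ℕ) {n : ℕ} {x : Fin n → A} {y : Fin n → B}
    (h : ∀ φ : InfFormula L n, φ.rank ≤ m → (φ.Realize x ↔ φ.Realize y)) :
    DuplicatorWins L m (Set.range fun i => (x i, y i)) := by
  have hiso : IsPartialIso L (Set.range fun i => (x i, y i)) :=
    isPartialIso_range_iff.2 ⟨fun i j => h (.equal i j) (by simp [InfFormula.rank]),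
      fun l R v => h (.rel R v) (by simp [InfFormula.rank])⟩
  induction m generalizing n with
  | zero => exact hiso
  | succ m ih =>
    have key : ∀ a b, (∀ φ : InfFormula L (n + 1), φ.rank ≤ m →
        (φ.Realize (Fin.snoc x a) ↔ φ.Realize (Fin.snoc y b))) →
        DuplicatorWins L m (insert (a, b) (Set.range fun i => (x i, y i))) := by
      intro a b hab
      rw [← range_snoc_prodMk]
      exact ih hab (isPartialIso_range_iff.2
        ⟨fun i j => hab (.equal i j) (by simp [InfFormula.rank]),
          fun l R v => hab (.rel R v) (by simp [InfFormula.rank])⟩)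
    refine ⟨hiso, fun a => ?_, fun b => ?_⟩
    · by_contra hcon
      -- Closure under negation lets the separating formula always be true on the side of the move.
      have hsep : ∀ b, ∃ φ : InfFormula L (n + 1), φ.rank ≤ m ∧
          φ.Realize (Fin.snoc x a) ∧ ¬ φ.Realize (Fin.snoc y b) := by
        intro b
        by_contra hb
        push Not at hb
        refine hcon ⟨b, key a b fun φ hφ => ⟨hb φ hφ, fun h1 => ?_⟩⟩
        by_contra h2
        exact hb (.neg φ) hφ h2 h1
      choose φ h1 h2 h3 using hsep
      obtain ⟨b, hb⟩ := (h (.ex (.conj φ)) (by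
        simpa [InfFormula.rank] using (add_le_add_left (iSup_le h1) 1 : _))).1 ⟨a, fun b => h2 b⟩
      exact h3 b (hb b)
    · by_contra hcon
      have hsep : ∀ a, ∃ φ : InfFormula L (n + 1), φ.rank ≤ m ∧
          φ.Realize (Fin.snoc y b) ∧ ¬ φ.Realize (Fin.snoc x a) := by
        intro a
        by_contra hb
        push Not at hb
        refine hcon ⟨a, key a b fun φ hφ => ⟨fun h1 => ?_, hb φ hφ⟩⟩
        by_contra h2
        exact hb (.neg φ) hφ h2 h1
      choose φ h1 h2 h3 using hsep
      obtain ⟨a, ha⟩ := (h (.ex (.conj φ)) (by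
        simpa [InfFormula.rank] using (add_le_add_left (iSup_le h1) 1 : _))).2 ⟨b, fun a => h2 a⟩
      exact h3 a (ha a)

/-! ### Finite vocabularies: finitary formulas describing types -/

theorem foRank_iInf_le {α : Type} {ι : Type u} [Finite ι] {n m : ℕ}
    (f : ι → L.BoundedFormula α n) (h : ∀ i, foRank (f i) ≤ m) :
    foRank (BoundedFormula.iInf f) ≤ m := by
  have key : ∀ l : List (L.BoundedFormula α n), (∀ φ ∈ l, foRank φ ≤ m) →
      foRank (l.foldr (· ⊓ ·) ⊤) ≤ m := by
    intro l
    induction l with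
    | nil => exact fun _ => Nat.zero_le _
    | cons φ l ih =>
      intro hl
      have h1 := hl φ (by simp)
      have h2 := ih fun ψ hψ => hl ψ (by simp [hψ])
      -- `φ ⊓ ψ` abbreviates `(φ → (ψ → ⊥)) → ⊥`; the zeros are the ranks of `⊥`.
      change max (max (foRank φ) (max (foRank (l.foldr (· ⊓ ·) ⊤)) 0)) 0 ≤ m
      simp [h1, h2]
  refine key _ fun φ hφ => ?_
  simp only [List.mem_map] at hφ
  obtain ⟨i, _, rfl⟩ := hφ
  exact h i

variable (L) in
/-- The atomic formulas in the variables `x_0, …, x_{n-1}`. -/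
def atomicFormula (n : ℕ) :
    (Fin n × Fin n) ⊕ (Σ R : (Σ l, L.Relations l), Fin R.1 → Fin n) → L.BoundedFormula Empty n
  | .inl p => .equal (.var (Sum.inr p.1)) (.var (Sum.inr p.2))
  | .inr p => .rel p.1.2 fun i => .var (Sum.inr (p.2 i))

theorem isPartialIso_of_atomicFormula {n : ℕ} {x : Fin n → A} {y : Fin n → B} {v : Empty → A}
    {w : Empty → B}
    (h : ∀ i, (atomicFormula L n i).Realize v x ↔ (atomicFormula L n i).Realize w y) :
    IsPartialIso L (Set.range fun i => (x i, y i)) :=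
  isPartialIso_range_iff.2 ⟨fun i j => h (.inl (i, j)), fun l R f => h (.inr ⟨⟨l, R⟩, f⟩)⟩

variable (L) in
/-- The formula stating exactly which members of a finite family hold. -/
noncomputable def typeFormula {ι : Type u} [Finite ι] {n : ℕ}
    (φ : ι → L.BoundedFormula Empty n) (S : Set ι) : L.BoundedFormula Empty n :=
  open Classical in BoundedFormula.iInf fun i => if i ∈ S then φ i else (φ i).not

theorem realize_typeFormula {ι : Type u} [Finite ι] {n : ℕ}
    {φ : ι → L.BoundedFormula Empty n} {S : Set ι} {v : Empty → A} {x : Fin n → A} :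
    (typeFormula L φ S).Realize v x ↔ ∀ i, (φ i).Realize v x ↔ i ∈ S := by
  simp only [typeFormula, BoundedFormula.realize_iInf]
  refine forall_congr' fun i => ?_
  by_cases hi : i ∈ S <;> simp [hi]

theorem foRank_typeFormula_le {ι : Type u} [Finite ι] {n m : ℕ}
    {φ : ι → L.BoundedFormula Empty n} (h : ∀ i, foRank (φ i) ≤ m) (S : Set ι) :
    foRank (typeFormula L φ S) ≤ m := by
  refine foRank_iInf_le _ fun i => ?_
  split_ifs
  · exact h i
  · exact max_le (h i) (Nat.zero_le _)

variable (L A B) in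
/-- Over a finite vocabulary, finitely many formulas of bounded quantifier rank decide the game. -/
theorem exists_finite_deciding_family [Finite (Σ n, L.Relations n)] (m n : ℕ) :
    ∃ (ι : Type u) (_ : Finite ι) (φ : ι → L.BoundedFormula Empty n),
      (∀ i, foRank (φ i) ≤ m) ∧ ∀ (x : Fin n → A) (y : Fin n → B),
        (∀ i, (φ i).Realize default x ↔ (φ i).Realize default y) →
          DuplicatorWins L m (Set.range fun i => (x i, y i)) := by
  induction m generalizing n with
  | zero =>
    refine ⟨_, inferInstance, atomicFormula L n, ?_, fun x y h => isPartialIso_of_atomicFormula h⟩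
    rintro (i | i) <;> exact le_rfl
  | succ m ih =>
    obtain ⟨ι, _, φ, hφ, h⟩ := ih (n + 1)
    -- Besides the atomic formulas, there is one formula for each subset `S` of the previous family,
    -- saying that some element realizes exactly the members of `S`. Finiteness survives passing to
    -- the power set.
    refine ⟨_ ⊕ Set ι, inferInstance,
      Sum.elim (atomicFormula L n) fun S => (typeFormula L φ S).ex, ?_, fun x y hxy => ?_⟩
    · rintro ((i | i) | S)
      · exact Nat.zero_le _
      · exact Nat.zero_le _
      · change max (max (foRank (typeFormula L φ S)) 0 + 1) 0 ≤ m + 1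
        have := foRank_typeFormula_le hφ S
        omega
    · refine ⟨isPartialIso_of_atomicFormula fun i => hxy (.inl i), fun a => ?_, fun b => ?_⟩
      -- `S` is the type of the move `a`; any element of the same type on the other side is a
      -- winning answer.
      · have h1 := hxy (.inr {i | (φ i).Realize default (Fin.snoc x a)})
        simp only [Sum.elim_inr, BoundedFormula.realize_ex, realize_typeFormula] at h1
        obtain ⟨b, hb⟩ := h1.1 ⟨a, fun i => Iff.rfl⟩
        refine ⟨b, ?_⟩
        rw [← range_snoc_prodMk]
        exact h _ _ fun i => (hb i).symm
      · have h1 := hxy (.inr {i | (φ i).Realize default (Fin.snoc y b)})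
        simp only [Sum.elim_inr, BoundedFormula.realize_ex, realize_typeFormula] at h1
        obtain ⟨a, ha⟩ := h1.2 ⟨b, fun i => Iff.rfl⟩
        refine ⟨a, ?_⟩
        rw [← range_snoc_prodMk]
        exact h _ _ fun i => ha i

theorem range_elim0_eq_empty (x : Fin 0 → A) (y : Fin 0 → B) :
    Set.range (fun i => (x i, y i)) = ∅ := Set.range_eq_empty _

theorem equivRank_iff_duplicatorWins (k : ℕ) :
    EquivRank L k A B ↔ DuplicatorWins L k (∅ : Set (A × B)) := by
  rw [← range_elim0_eq_empty Fin.elim0 Fin.elim0]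
  exact ⟨duplicatorWins_of_realize_iff k, fun h φ hφ => h.realize_iff φ k hφ⟩

theorem foEquivRank_iff_duplicatorWins [L.IsRelational] [Finite (Σ n, L.Relations n)] (k : ℕ) :
    FOEquivRank L k A B ↔ DuplicatorWins L k (∅ : Set (A × B)) := by
  rw [← range_elim0_eq_empty default default]
  constructor
  · intro h
    obtain ⟨ι, _, φ, hφ, h1⟩ := exists_finite_deciding_family L A B k 0
    exact h1 _ _ fun i => h (φ i) (hφ i)
  · exact fun h φ hφ => h.realize_boundedFormula_iff φ k hφ

end Game

/-! ### From open spans to winning strategies -/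

section PathExtension

variable {L : FirstOrder.Language.{u, u}} [L.IsRelational] {k : ℕ} {C : Type u}
  [(plus L).Structure C]

/-- On a path the comparability clause of `cofree` is automatic, leaving only the relation between
last elements. -/
theorem relMap_last_iff_of_isEmbedding {P : TreeStr (plus L) k} (hP : IsPath P)
    {f : P ⟶ cofree (plus L) k C} (hf : TreeStr.IsEmbedding f) {n : ℕ} (R : (plus L).Relations n)
    (v : Fin n → P.carrier) :
    Structure.RelMap R v ↔ Structure.RelMap R (fun i => Play.last (TreeStr.Hom.toHom f (v i))) :=
  ⟨fun h => ((TreeStr.Hom.toHom f).map_rel R v h).2, fun h => hf.2 n R v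
    ⟨fun i j => (hP.1 (v i) (v j)).imp (fun h => TreeStr.hom_mono f h)
      fun h => TreeStr.hom_mono f h, h⟩⟩

/-- This is where `I` encodes equality: equal last elements make the images `I`-related, an
embedding reflects this, and on a path `I` is the identity. -/
theorem last_injective_of_isEmbedding
    (hI : ∀ v : Fin 2 → C, Structure.RelMap (symI L) v ↔ v 0 = v 1)
    {P : TreeStr (plus L) k} (hP : IsPath P)
    {f : P ⟶ cofree (plus L) k C} (hf : TreeStr.IsEmbedding f) {x y : P.carrier}
    (h : Play.last (TreeStr.Hom.toHom f x) = Play.last (TreeStr.Hom.toHom f y)) : x = y :=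
  (hP.2 x y).1 ((relMap_last_iff_of_isEmbedding hP hf _ _).2 ((hI _).2 h))

/-- Openness lets a path embedding be extended so as to meet a prescribed last element. -/
theorem exists_path_extension
    (hI : ∀ v : Fin 2 → C, Structure.RelMap (symI L) v ↔ v 0 = v 1)
    {R : TreeStr (plus L) k} {p : R ⟶ cofree (plus L) k C} (hop : IsOpenMorphism p)
    (hpw : IsPathwiseEmbedding p) {P : TreeStr (plus L) k} (hP : IsPath P) {e : P ⟶ R}
    (he : TreeStr.IsEmbedding e) (hcard : Nat.card P.carrier < k) (c : C) :
    ∃ (Q : TreeStr (plus L) k) (d : Q ⟶ R) (s : Q.carrier), IsPath Q ∧ TreeStr.IsEmbedding d ∧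
      Nat.card Q.carrier ≤ Nat.card P.carrier + 1 ∧
      Play.last (TreeStr.Hom.toHom p (TreeStr.Hom.toHom d s)) = c ∧
      (∀ y, y = s ∨ ∃ x, TreeStr.Hom.toHom e x = TreeStr.Hom.toHom d y) ∧
      ∀ x, ∃ y, TreeStr.Hom.toHom d y = TreeStr.Hom.toHom e x := by
  -- If `c` already occurs the path is kept: appending `c` again would relate two distinct elements
  -- by `I`, and the result would not be a path.
  by_cases hc : ∃ x, Play.last (TreeStr.Hom.toHom p (TreeStr.Hom.toHom e x)) = c
  · obtain ⟨x, hx⟩ := hc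
    exact ⟨P, e, x, hP, he, Nat.le_succ _, hx, fun y => Or.inr ⟨y, rfl⟩, fun y => ⟨y, rfl⟩⟩
  push Not at hc
  have hf := hpw P e hP he
  obtain ⟨l, -, hlP, hl⟩ := exists_list_of_linear hP.1 (e ≫ p)
  let s : Play k C := ⟨l ++ [c], by simp, by simp; omega⟩
  have hslast : s.last = c := by simp [s, Play.last]
  have hIic : ∀ t : Play k C, t ≤ s ↔ t = s ∨ ∃ x, TreeStr.Hom.toHom (e ≫ p) x = t := by
    intro t
    rw [← hl, Play.ext_iff]
    exact List.prefix_concat_iff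
  -- `Q` is the branch of `cofree (plus L) k C` below `s`, that is, the image of `P` with `s` on
  -- top; openness lifts it to `R`.
  let S : Set (cofree (plus L) k C).carrier := Set.Iic s
  have hS : IsLowerSet S := isLowerSet_Iic s
  let Q : TreeStr (plus L) k := (cofree (plus L) k C).restrict S hS
  let b : Q ⟶ cofree (plus L) k C := (cofree (plus L) k C).incl S hS
  have hmem : ∀ x, TreeStr.Hom.toHom (e ≫ p) x ∈ S := fun x => (hIic _).2 (Or.inr ⟨x, rfl⟩)
  let i : P ⟶ Q := TreeStr.lift (e ≫ p) S hS hmem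
  have hib : i ≫ b = e ≫ p := rfl
  let s' : Q.carrier := (⟨s, le_refl s⟩ : Set.Iic s)
  have hcover : ∀ y : Q.carrier, y = s' ∨ ∃ x, TreeStr.Hom.toHom i x = y := by
    intro y
    rcases (hIic _).1 (show TreeStr.Hom.toHom b y ≤ s from Subtype.prop (p := (· ∈ S)) y)
      with h | ⟨x, hx⟩
    · exact Or.inl (Subtype.ext h)
    · exact Or.inr ⟨x, Subtype.ext hx⟩
  have hb : TreeStr.IsEmbedding b := TreeStr.incl_isEmbedding _ _ _
  have hQlin : ∀ x y : Q.carrier, x ≤ y ∨ y ≤ x := fun x y =>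
    Play.le_total_of_le (r := s) (Subtype.prop (p := (· ∈ S)) x) (Subtype.prop (p := (· ∈ S)) y)
  have hlast : ∀ x y : Q.carrier, Play.last (TreeStr.Hom.toHom b x) =
      Play.last (TreeStr.Hom.toHom b y) → x = y := by
    intro x y hxy
    rcases hcover x with rfl | ⟨x, rfl⟩ <;> rcases hcover y with rfl | ⟨y, rfl⟩
    · rfl
    · exact (hc y (hxy.symm.trans hslast)).elim
    · exact (hc x (hxy.trans hslast)).elim
    · exact congrArg _ (last_injective_of_isEmbedding hI hP hf hxy)
  have hQ : IsPath Q := by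
    refine ⟨hQlin, fun x y => ⟨fun h => hlast x y ((hI _).1 h.2), ?_⟩⟩
    rintro rfl
    refine ⟨fun j j' => Or.inl (le_of_eq ?_), (hI _).2 rfl⟩
    fin_cases j <;> fin_cases j' <;> rfl
  obtain ⟨d, hd, hid, hdp⟩ :=
    hop P Q i e b hP hQ (TreeStr.IsEmbedding.of_comp (g := b) hf) he hb hib
  have hide : ∀ x, TreeStr.Hom.toHom d (TreeStr.Hom.toHom i x) = TreeStr.Hom.toHom e x :=
    fun x => congrArg (fun f => TreeStr.Hom.toHom f x) hid
  refine ⟨Q, d, s', hQ, hd, ?_, ?_, ?_, fun x => ⟨_, hide x⟩⟩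
  · have := finite_of_linear hP.1
    rw [← Finite.card_option]
    refine Nat.card_le_card_of_surjective
      (fun o : Option P.carrier => o.elim s' (TreeStr.Hom.toHom i)) fun y => ?_
    rcases hcover y with rfl | ⟨x, rfl⟩
    · exact ⟨none, rfl⟩
    · exact ⟨some x, rfl⟩
  · exact (congrArg (fun f => Play.last (TreeStr.Hom.toHom f s')) hdp).trans hslast
  · intro y
    rcases hcover y with rfl | ⟨x, rfl⟩
    · exact Or.inl rfl
    · exact Or.inr ⟨x, (hide x).symm⟩

end PathExtension

/-! ### Lists of moves along which Duplicator keeps winning -/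

section WinningList

variable {L : FirstOrder.Language.{u, u}} {k : ℕ} {A B : Type u} [L.Structure A] [L.Structure B]

variable (L k) in
/-- The lists of moves all of whose initial segments are winning for Duplicator. -/
def WinningList (l : List (A × B)) : Prop :=
  ∀ l' : List (A × B), l' <+: l → DuplicatorWins L (k - l'.length) {x | x ∈ l'}

theorem WinningList.of_prefix (l l' : List (A × B)) (h : l <+: l') (hl : WinningList L k l') :
    WinningList L k l := fun r hr => hl r (hr.trans h)

theorem WinningList.concat {l : List (A × B)} (hl : WinningList L k l) {d : A × B}
    (h : DuplicatorWins L (k - (l.length + 1)) (insert d {x | x ∈ l})) :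
    WinningList L k (l ++ [d]) := by
  intro r hr
  rcases List.prefix_concat_iff.1 hr with rfl | hr
  · have : {x | x ∈ l ++ [d]} = insert d {x | x ∈ l} := by
      ext x
      simp [or_comm]
    simpa only [this, List.length_append, List.length_singleton] using h
  · exact hl r hr

theorem WinningList.exists_concat {l : List (A × B)} (hl : WinningList L k l)
    (hk : l.length < k) :
    (∀ a, ∃ d : A × B, d.1 = a ∧ WinningList L k (l ++ [d])) ∧
      ∀ b, ∃ d : A × B, d.2 = b ∧ WinningList L k (l ++ [d]) := by
  have h := hl l List.prefix_rfl
  rw [show k - l.length = k - (l.length + 1) + 1 by omega] at h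
  refine ⟨fun a => ?_, fun b => ?_⟩
  · obtain ⟨b, hb⟩ := h.2.1 a
    exact ⟨(a, b), rfl, hl.concat hb⟩
  · obtain ⟨a, ha⟩ := h.2.2 b
    exact ⟨(a, b), rfl, hl.concat ha⟩

/-- For `I` this is the equality clause of a partial isomorphism. -/
theorem IsPartialIso.relMap_expand_iff {ρ : Set (A × B)} (h : IsPartialIso L ρ) {n : ℕ}
    (R : (plus L).Relations n) (v : Fin n → A × B) (hv : ∀ i, v i ∈ ρ) :
    (expand L A).RelMap R (fun i => (v i).1) ↔ (expand L B).RelMap R (fun i => (v i).2) := by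
  rcases R with R | R
  · exact h.rel_iff n R v hv
  · cases R
    exact h.eq_iff _ (hv 0) _ (hv 1)

end WinningList

/-! ### Game positions read off a span -/

section Span

variable {L : FirstOrder.Language.{u, u}} [L.IsRelational] {k : ℕ} {A B : Type u}
  [L.Structure A] [L.Structure B]

/-- The position of the game reached by a path in a span over `F_k A` and `F_k B`. -/
def spanPosition {R P : TreeStr (plus L) k} (p : R ⟶ F L k A) (q : R ⟶ F L k B) (e : P ⟶ R) :
    Set (A × B) :=
  Set.range fun x => (Play.last (TreeStr.Hom.toHom p (TreeStr.Hom.toHom e x)),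
    Play.last (TreeStr.Hom.toHom q (TreeStr.Hom.toHom e x)))

theorem spanPosition_extension {R P Q : TreeStr (plus L) k} {p : R ⟶ F L k A} {q : R ⟶ F L k B}
    {e : P ⟶ R} {d : Q ⟶ R} {s : Q.carrier}
    (h1 : ∀ y, y = s ∨ ∃ x, TreeStr.Hom.toHom e x = TreeStr.Hom.toHom d y)
    (h2 : ∀ x, ∃ y, TreeStr.Hom.toHom d y = TreeStr.Hom.toHom e x) :
    spanPosition p q d = insert (Play.last (TreeStr.Hom.toHom p (TreeStr.Hom.toHom d s)),
      Play.last (TreeStr.Hom.toHom q (TreeStr.Hom.toHom d s))) (spanPosition p q e) := by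
  refine Set.Subset.antisymm ?_ (Set.insert_subset ⟨s, rfl⟩ ?_)
  · rintro _ ⟨y, rfl⟩
    rcases h1 y with rfl | ⟨x, hx⟩
    · exact Set.mem_insert _ _
    · exact Set.mem_insert_of_mem _ ⟨x, by simp only [hx]⟩
  · rintro _ ⟨x, rfl⟩
    obtain ⟨y, hy⟩ := h2 x
    exact ⟨y, by simp only [hy]⟩

/-- `e ≫ p` and `e ≫ q` embed the same path, so equalities and relations on either side are those of
`P`. -/
theorem isPartialIso_spanPosition {R P : TreeStr (plus L) k} {p : R ⟶ F L k A} {q : R ⟶ F L k B}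
    (hp : IsPathwiseEmbedding p) (hq : IsPathwiseEmbedding q) (hP : IsPath P) {e : P ⟶ R}
    (he : TreeStr.IsEmbedding e) : IsPartialIso L (spanPosition p q e) := by
  let sA := expand L A
  let sB := expand L B
  have hIA : ∀ v : Fin 2 → A, Structure.RelMap (symI L) v ↔ v 0 = v 1 := fun _ => Iff.rfl
  have hIB : ∀ v : Fin 2 → B, Structure.RelMap (symI L) v ↔ v 0 = v 1 := fun _ => Iff.rfl
  have hpe := hp P e hP he
  have hqe := hq P e hP he
  refine ⟨?_, fun n S v hv => ?_⟩
  · rintro _ ⟨x, rfl⟩ _ ⟨y, rfl⟩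
    constructor
    · intro h
      rw [last_injective_of_isEmbedding hIA hP hpe h]
    · intro h
      rw [last_injective_of_isEmbedding hIB hP hqe h]
  · choose w hw using hv
    obtain rfl := funext hw
    exact (relMap_last_iff_of_isEmbedding hP hpe (Sum.inl S) w).symm.trans
      (relMap_last_iff_of_isEmbedding hP hqe (Sum.inl S) w)

/-- `Nat.card P.carrier` bounds the rounds that the path accounts for. Answering a move lengthens
the path by at most one element, so the bound `hn` is maintained while `n` drops. -/
theorem duplicatorWins_spanPosition {R : TreeStr (plus L) k} {p : R ⟶ F L k A} {q : R ⟶ F L k B}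
    (hp : IsOpenMorphism p ∧ IsPathwiseEmbedding p)
    (hq : IsOpenMorphism q ∧ IsPathwiseEmbedding q) (n : ℕ) {P : TreeStr (plus L) k}
    (hP : IsPath P) {e : P ⟶ R} (he : TreeStr.IsEmbedding e) (hn : Nat.card P.carrier + n ≤ k) :
    DuplicatorWins L n (spanPosition p q e) := by
  let sA := expand L A
  let sB := expand L B
  have hIA : ∀ v : Fin 2 → A, Structure.RelMap (symI L) v ↔ v 0 = v 1 := fun _ => Iff.rfl
  have hIB : ∀ v : Fin 2 → B, Structure.RelMap (symI L) v ↔ v 0 = v 1 := fun _ => Iff.rfl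
  induction n generalizing P with
  | zero => exact isPartialIso_spanPosition hp.2 hq.2 hP he
  | succ n ih =>
    refine ⟨isPartialIso_spanPosition hp.2 hq.2 hP he, fun a => ?_, fun b => ?_⟩
    · obtain ⟨Q, d, s, hQ, hd, hc, rfl, h1, h2⟩ :=
        exists_path_extension hIA hp.1 hp.2 hP he (by omega) a
      refine ⟨Play.last (TreeStr.Hom.toHom q (TreeStr.Hom.toHom d s)), ?_⟩
      have hw := ih hQ hd (by omega)
      rw [spanPosition_extension h1 h2] at hw
      exact hw
    · obtain ⟨Q, d, s, hQ, hd, hc, rfl, h1, h2⟩ :=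
        exists_path_extension hIB hq.1 hq.2 hP he (by omega) b
      refine ⟨Play.last (TreeStr.Hom.toHom p (TreeStr.Hom.toHom d s)), ?_⟩
      have hw := ih hQ hd (by omega)
      rw [spanPosition_extension h1 h2] at hw
      exact hw

theorem BackAndForth.duplicatorWins (h : BackAndForth L k A B) :
    DuplicatorWins L k (∅ : Set (A × B)) := by
  obtain ⟨R, p, q, hp, hq⟩ := h
  -- The empty path is the initial position.
  let P := R.restrict ∅ isLowerSet_empty
  have hE : IsEmpty P.carrier := inferInstanceAs (IsEmpty (∅ : Set R.carrier))
  have hP : IsPath P := ⟨fun x => hE.elim x, fun x => hE.elim x⟩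
  have h := duplicatorWins_spanPosition hp hq k hP (R.incl_isEmbedding ∅ isLowerSet_empty)
    (by rw [Nat.card_of_isEmpty, Nat.zero_add])
  rwa [spanPosition, Set.range_eq_empty] at h

/-! ### From winning strategies to open spans -/

theorem DuplicatorWins.backAndForth (h : DuplicatorWins L k (∅ : Set (A × B))) :
    BackAndForth L k A B := by
  let sA := expand L A
  let sB := expand L B
  -- Relations on pairs are pulled back from `A`, so the first projection respects them by
  -- definition. The second does so only along winning lists, whose entries form a partial
  -- isomorphism.
  let sAB : (plus L).Structure (A × B) :=
    { funMap := fun f => isEmptyElim f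
      RelMap := fun R v => (expand L A).RelMap R fun i => (v i).1 }
  have h0 : WinningList L k ([] : List (A × B)) := by
    intro r hr
    rw [List.prefix_nil.1 hr]
    simpa using h
  have hrelA : ∀ l : List (A × B), WinningList L k l → ∀ (n : ℕ) (R : (plus L).Relations n)
      (v : Fin n → A × B), (∀ i, v i ∈ l) →
      (Structure.RelMap R v ↔ Structure.RelMap R (fun i => (v i).1)) :=
    fun _ _ _ _ _ _ => Iff.rfl
  have hrelB : ∀ l : List (A × B), WinningList L k l → ∀ (n : ℕ) (R : (plus L).Relations n)
      (v : Fin n → A × B), (∀ i, v i ∈ l) →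
      (Structure.RelMap R v ↔ Structure.RelMap R (fun i => (v i).2)) :=
    fun l hl n R v hv => (hl l List.prefix_rfl).isPartialIso.relMap_expand_iff R v hv
  exact ⟨playTree (plus L) k (WinningList L k) WinningList.of_prefix,
    playProj h0 WinningList.of_prefix Prod.fst hrelA,
    playProj h0 WinningList.of_prefix Prod.snd hrelB,
    ⟨playProj_isOpenMorphism h0 _ _ hrelA fun l hl hk => (hl.exists_concat hk).1,
      playProj_isPathwiseEmbedding h0 _ _ hrelA⟩,
    ⟨playProj_isOpenMorphism h0 _ _ hrelB fun l hl hk => (hl.exists_concat hk).2,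
      playProj_isPathwiseEmbedding h0 _ _ hrelB⟩⟩

theorem duplicatorWins_iff_backAndForth :
    DuplicatorWins L k (∅ : Set (A × B)) ↔ BackAndForth L k A B :=
  ⟨DuplicatorWins.backAndForth, BackAndForth.duplicatorWins⟩

end Span

end EFComonad

theorem mainTheorem5 (L : FirstOrder.Language.{u, u}) [L.IsRelational]
    (harity : IsEmpty (L.Relations 0)) (k : ℕ) (hk : 0 < k)
    (A B : Type u) [L.Structure A] [L.Structure B] :
    (EFComonad.EquivRank L k A B ↔ EFComonad.BackAndForth L k A B) ∧
    (Finite (Σ n, L.Relations n) →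
      (EFComonad.FOEquivRank L k A B ↔ EFComonad.BackAndForth L k A B)) :=
  ⟨(EFComonad.equivRank_iff_duplicatorWins k).trans EFComonad.duplicatorWins_iff_backAndForth,
    fun _ => (EFComonad.foEquivRank_iff_duplicatorWins k).trans
      EFComonad.duplicatorWins_iff_backAndForth⟩
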